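/- Let $d$ be a prime, $n$ a natural number, and $\xi=e^{2\pi i/d}$; consider $n$-qudit systems $(\mathbb{C}^d)^{\otimes n}$ with computational basis $|\vec i\rangle$, $\vec i\in\mathbb{Z}_d^n$. Let $G=\begin{pmatrix} g_{00}&g_{01}\\ g_{10}&g_{11}\end{pmatrix}$ be an invertible matrix over $\mathbb{Z}_d$ that is positive, i.e. none of its entries is $0$ in $\mathbb{Z}_d$. Let $U=\sum_{\vec i,\vec j}|\vec i'\rangle\langle\vec i|\otimes|\vec j'\rangle\langle\vec j|$, where $(i'_k,j'_k)^T=(G^{-1})^T(i_k,j_k)^T$ for each $k$, and define the convolution of two $n$-qudit states by $\rho\boxtimes\sigma=\mathrm{Tr}_B[U(\rho\otimes\sigma)U^\dagger]$, the partial trace being over the second $n$-qudit system. For states $\rho,\tau$ let $D(\rho\|\tau)=\mathrm{Tr}[\rho(\log\rho-\log\tau)]$ if $\operatorname{supp}\rho\subseteq\operatorname{supp}\tau$, and $D(\rho\|\tau)=+\infty$ otherwise. For a Hermitian operator $H$ put $\rho_\theta=e^{i\theta H}\rho e^{-i\theta H}$ and $$J(\rho;H)=\frac{d^2}{d\theta^2}\Big|_{\theta=0}D(\rho\|\rho_\theta),$$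 with $J(\rho;H)=+\infty$ if $D(\rho\|\rho_\theta)$ is not finite for all $\theta$ near $0$. On one qudit let $X|k\rangle=|k+1\rangle$ and $Z|k\rangle=\xi^k|k\rangle$. For $R=X_k$ or $Z_k$ (the operator $X$ or $Z$ on the $k$-th qudit) and $j\in\mathbb{Z}_d$ let $H_j^R=|j\rangle\langle j|_R$, where $|j\rangle_R$ is the unit eigenvector of $X$ (resp. $Z$) on the $k$-th qudit with eigenvalue $\xi^j$, and $|j\rangle\langle j|_R$ is tensored with the identity on the other qudits. Define $$J(\rho)=\sum_{k=1}^n\sum_{j\in\mathbb{Z}_d}\left(J(\rho;H_j^{X_k})+J(\rho;H_j^{Z_k})\right)\in[0,+\infty].$$ Then for all $n$-qudit states $\rho$ and $\sigma$, $$J(\rho\boxtimes\sigma)\le\min\{J(\rho),J(\sigma)\}.$$ -/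

import Mathlib

open scoped Matrix Kronecker Topology ComplexOrder

noncomputable section

namespace QuditConv

/-- Labels of the computational basis of `n` qudits of local dimension `d`:
the vectors of `ℤ_d ^ n`. -/
abbrev Idx (d n : ℕ) : Type := Fin n → ZMod d

/-- Operators on the `n`-qudit space, in the computational basis. -/
abbrev Op (d n : ℕ) : Type := Matrix (Idx d n) (Idx d n) ℂ

/-- A quantum state (density matrix): positive semidefinite with trace one. -/
def IsState {ι : Type*} [Fintype ι] (ρ : Matrix ι ι ℂ) : Prop :=
  ρ.PosSemidef ∧ ρ.trace = 1

/-! ### Convolution -/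

section Convolution

variable {d : ℕ} [NeZero d] {n : ℕ}

/-- The map `(i, j) ↦ (i', j')` on pairs of labels, where
`(i'_k, j'_k) = (G⁻¹)ᵀ (i_k, j_k)` for every qudit `k`. -/
def keyMap (G : Matrix (Fin 2) (Fin 2) (ZMod d)) (x : Idx d n × Idx d n) :
    Idx d n × Idx d n :=
  (fun k => ((G⁻¹)ᵀ *ᵥ ![x.1 k, x.2 k]) 0, fun k => ((G⁻¹)ᵀ *ᵥ ![x.1 k, x.2 k]) 1)

/-- The key unitary `U = ∑_{i,j} |i'⟩⟨i| ⊗ |j'⟩⟨j|` on `2n` qudits. -/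
def keyUnitary (G : Matrix (Fin 2) (Fin 2) (ZMod d)) :
    Matrix (Idx d n × Idx d n) (Idx d n × Idx d n) ℂ :=
  Matrix.of fun y x => if y = keyMap G x then 1 else 0

/-- Partial trace over the second tensor factor. -/
def partialTraceB {ι κ : Type*} [Fintype κ] (M : Matrix (ι × κ) (ι × κ) ℂ) : Matrix ι ι ℂ :=
  Matrix.of fun a a' => ∑ b, M (a, b) (a', b)

/-- The convolution `ρ ⊠ σ = Tr_B (U (ρ ⊗ σ) U†)` with parameter matrix `G`. -/
def convolution (G : Matrix (Fin 2) (Fin 2) (ZMod d)) (ρ σ : Op d n) : Op d n :=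
  partialTraceB (keyUnitary G * (ρ ⊗ₖ σ) * (keyUnitary G)ᴴ)

end Convolution

/-! ### Relative entropy and divergence-based Fisher information -/

section Fisher

variable {ι : Type*} [Fintype ι] [DecidableEq ι]

open scoped Classical in
/-- The quantum relative entropy `D(ρ‖σ) = Tr (ρ (log ρ - log σ))` if the support of `ρ` is
contained in the support of `σ` (that is, `ker σ ⊆ ker ρ`), and `+∞` otherwise. The logarithm is
taken by the functional calculus, with `log 0 = 0`, so it is the logarithm on the support. -/
def relEntropy (ρ σ : Matrix ι ι ℂ) : EReal :=
  if ∀ v : ι → ℂ, σ *ᵥ v = 0 → ρ *ᵥ v = 0 then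
    (((ρ * (cfc Real.log ρ - cfc Real.log σ)).trace.re : ℝ) : EReal)
  else ⊤

open scoped Classical in
/-- The divergence-based Fisher information at `θ = 0` of a one-parameter family of states:
the second derivative at `0` of `θ ↦ D(ρ_0‖ρ_θ)` if this divergence is finite for all `θ`
near `0`, and `+∞` otherwise. -/
def familyFisherInfo (ρ : ℝ → Matrix ι ι ℂ) : EReal :=
  if ∀ᶠ θ in 𝓝 (0 : ℝ), relEntropy (ρ 0) (ρ θ) ≠ ⊤ then
    ((iteratedDeriv 2 (fun θ => (relEntropy (ρ 0) (ρ θ)).toReal) 0 : ℝ) : EReal)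
  else ⊤

/-- The family `ρ_θ = exp(iθH) ρ exp(-iθH)`. -/
def unitaryFamily (ρ H : Matrix ι ι ℂ) (θ : ℝ) : Matrix ι ι ℂ :=
  NormedSpace.exp ((Complex.I * (θ : ℂ)) • H) * ρ * NormedSpace.exp (-(Complex.I * (θ : ℂ)) • H)

/-- `J(ρ; H)`, the Fisher information of the family `exp(iθH) ρ exp(-iθH)`. -/
def fisherInfoAlong (ρ H : Matrix ι ι ℂ) : EReal :=
  familyFisherInfo (unitaryFamily ρ H)

end Fisher

/-! ### Generators from the eigenbases of the Pauli operators -/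

section Pauli

variable {d : ℕ} [NeZero d]

/-- The one-qudit Pauli operator `X : |k⟩ ↦ |k + 1⟩`. -/
def pauliX (d : ℕ) : Matrix (ZMod d) (ZMod d) ℂ :=
  Matrix.of fun l k => if l = k + 1 then 1 else 0

/-- The one-qudit Pauli operator `Z : |k⟩ ↦ ξ ^ k |k⟩`, where `ξ = exp(2πi/d)`;
`ZMod.stdAddChar k` is `ξ ^ k`. -/
def pauliZ (d : ℕ) [NeZero d] : Matrix (ZMod d) (ZMod d) ℂ :=
  Matrix.diagonal fun k => ZMod.stdAddChar k

/-- The unit eigenvector `|j⟩_X = d^{-1/2} ∑_k ξ ^ (-jk) |k⟩` of `X` for the eigenvalue `ξ ^ j`. -/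
def eigvecX (j : ZMod d) : ZMod d → ℂ :=
  fun k => ((Real.sqrt d : ℝ) : ℂ)⁻¹ * ZMod.stdAddChar (-(j * k))

/-- The unit eigenvector `|j⟩_Z = |j⟩` of `Z` for the eigenvalue `ξ ^ j`. -/
def eigvecZ (j : ZMod d) : ZMod d → ℂ := Pi.single j 1

theorem pauliX_mulVec_eigvecX (j : ZMod d) :
    pauliX d *ᵥ eigvecX j = (ZMod.stdAddChar j : ℂ) • eigvecX j := by
  ext l
  have h : ∀ k : ZMod d, l = k + 1 ↔ l - 1 = k := fun k => by
    constructor <;> intro h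
    · rw [h]; ring
    · rw [← h]; ring
  simp only [pauliX, Matrix.mulVec, dotProduct, Matrix.of_apply, h, ite_mul, one_mul, zero_mul,
    Finset.sum_ite_eq, Finset.mem_univ, if_true, eigvecX, Pi.smul_apply, smul_eq_mul]
  rw [show -(j * (l - 1)) = j + -(j * l) by ring, AddChar.map_add_eq_mul]
  ring

theorem pauliZ_mulVec_eigvecZ (j : ZMod d) :
    pauliZ d *ᵥ eigvecZ j = (ZMod.stdAddChar j : ℂ) • eigvecZ j := by
  ext l
  by_cases h : l = j
  · subst h; simp [pauliZ, eigvecZ, Matrix.mulVec_diagonal]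
  · simp [pauliZ, eigvecZ, Matrix.mulVec_diagonal, Pi.single_eq_of_ne h]

/-- The operator `|v⟩⟨v|`. -/
def proj {κ : Type*} (v : κ → ℂ) : Matrix κ κ ℂ := Matrix.vecMulVec v (star v)

/-- The one-qudit operator `A` acting on the `k`-th of `n` qudits, tensored with the identity
on all the others. -/
def onQudit {n : ℕ} (k : Fin n) (A : Matrix (ZMod d) (ZMod d) ℂ) : Op d n :=
  Matrix.of fun x y => if ∀ l, l ≠ k → x l = y l then A (x k) (y k) else 0

/-- The generator `H_j = |j⟩⟨j|` for the Pauli operator `X_k`. -/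
def genX {n : ℕ} (k : Fin n) (j : ZMod d) : Op d n := onQudit k (proj (eigvecX j))

/-- The generator `H_j = |j⟩⟨j|` for the Pauli operator `Z_k`. -/
def genZ {n : ℕ} (k : Fin n) (j : ZMod d) : Op d n := onQudit k (proj (eigvecZ j))

/-- The Fisher information `J(ρ)`, summed over the generators of all `X_k` and `Z_k`. -/
def fisherInfo {n : ℕ} (ρ : Op d n) : EReal :=
  ∑ k : Fin n, ∑ j : ZMod d, (fisherInfoAlong ρ (genX k j) + fisherInfoAlong ρ (genZ k j))

end Pauli

end QuditConv

end

/-! If `fisherInfo ρ = ⊤` there is nothing to prove. Otherwise finiteness forces `ker ρ` to be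
invariant under all spectral projections of the `X_k` and `Z_k`, hence under the Weyl operators.
These act irreducibly, so `ρ` is positive definite (`posDef_of_fisherInfo_ne_top`).

For positive definite `ρ` and a projection `H`, `D(ρ‖ρ_θ)` is a trigonometric polynomial in `θ`, so
its second derivative is explicit. Summing over the spectral projections of a Pauli operator `R`
turns `∑ H_j log ρ H_j` into a group average, and the total is `(2/d) ∑_a D(ρ‖R^a ρ R^{-a})`
(`IsUnitaryRep.sum_fisherInfoAlong`).

For fixed `σ`, `ρ ↦ ρ ⊠ σ` is a quantum channel that carries Weyl conjugations to Weyl conjugations,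
with exponents rescaled by nonzero constants (`phaseZ_conj_convolution`, `shiftX_conj_convolution`).
As `d` is prime, rescaling permutes the exponents, so data processing (`relEnt_krausMap_le`)
compares the two sums term by term. Exchanging the columns of `G` exchanges `ρ` and `σ`, which gives
the other bound.

Data processing comes from writing relative entropy as an integral over `t` of quadratic forms, each
a supremum of `divergenceQuad t ρ τ`. The Kadison–Schwarz inequality makes each supremum monotone
under channels. -/

open QuditConv

/-! ### Integral representation of the scalar relative entropy -/

section LogKernel

open MeasureTheory

/-- The kernel is `(y - x) ^ 2 / (y + t * x)`, a form quadratic in `y - x`, with weight `(1 + t)⁻²`.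
The primitive runs from `x * log y - (y - x)` at `0` to `x * log x` at infinity, which is how the
logarithms of the relative entropy arise. -/
theorem hasDerivAt_log_kernel_primitive {x y t : ℝ} (hx : 0 < x) (hy : 0 < y) (ht : 0 ≤ t) :
    HasDerivAt (fun s : ℝ => x * (Real.log (y + s * x) - Real.log (1 + s)) - (y - x) * (1 + s)⁻¹)
      ((y - x) ^ 2 / (y + t * x) * (((1 + t) ^ 2)⁻¹)) t := by
  have h1 : y + t * x ≠ 0 := by positivity
  have h2 : 1 + t ≠ 0 := by positivity
  have d1 : HasDerivAt (fun s : ℝ => y + s * x) x t := by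
    simpa using ((hasDerivAt_id t).mul_const x).const_add y
  have d2 : HasDerivAt (fun s : ℝ => 1 + s) 1 t := by
    simpa using (hasDerivAt_id t).const_add 1
  refine ((((d1.log h1).sub (d2.log h2)).const_mul x).sub
    ((d2.inv h2).const_mul (y - x))).congr_deriv ?_
  field_simp
  ring

theorem tendsto_log_kernel_primitive {x y : ℝ} (hx : 0 < x) (hy : 0 < y) :
    Filter.Tendsto
      (fun s : ℝ => x * (Real.log (y + s * x) - Real.log (1 + s)) - (y - x) * (1 + s)⁻¹)
      Filter.atTop (𝓝 (x * Real.log x)) := by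
  have h0 : Filter.Tendsto (fun s : ℝ => (1 + s)⁻¹) Filter.atTop (𝓝 0) :=
    tendsto_inv_atTop_zero.comp (Filter.tendsto_atTop_add_const_left _ _ Filter.tendsto_id)
  have h1 : Filter.Tendsto (fun s : ℝ => x + (y - x) * (1 + s)⁻¹) Filter.atTop (𝓝 x) := by
    simpa using (h0.const_mul (y - x)).const_add x
  have h2 := ((h1.log hx.ne').const_mul x).sub (h0.const_mul (y - x))
  rw [mul_zero, sub_zero] at h2
  refine h2.congr' ?_
  filter_upwards [Filter.eventually_gt_atTop 0] with s hs
  -- The quotient `(y + s * x) / (1 + s)` equals `x + (y - x) / (1 + s)`.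
  rw [← Real.log_div (by positivity) (by positivity)]
  congr 3
  field_simp
  ring

theorem integrableOn_log_kernel {x y : ℝ} (hx : 0 < x) (hy : 0 < y) :
    IntegrableOn (fun t : ℝ => (y - x) ^ 2 / (y + t * x) * (((1 + t) ^ 2)⁻¹)) (Set.Ioi 0) := by
  refine integrableOn_Ioi_deriv_of_nonneg
    (hasDerivAt_log_kernel_primitive hx hy le_rfl).continuousAt.continuousWithinAt
    (fun t ht => hasDerivAt_log_kernel_primitive hx hy (le_of_lt ht)) (fun t ht => ?_)
    (tendsto_log_kernel_primitive hx hy)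
  have : 0 < t := ht
  positivity

theorem integral_log_kernel {x y : ℝ} (hx : 0 < x) (hy : 0 < y) :
    ∫ t in Set.Ioi (0 : ℝ), (y - x) ^ 2 / (y + t * x) * (((1 + t) ^ 2)⁻¹) =
      x * (Real.log x - Real.log y) - x + y := by
  rw [integral_Ioi_of_hasDerivAt_of_tendsto
    (hasDerivAt_log_kernel_primitive hx hy le_rfl).continuousAt.continuousWithinAt
    (fun t ht => hasDerivAt_log_kernel_primitive hx hy (le_of_lt ht))
    (integrableOn_log_kernel hx hy) (tendsto_log_kernel_primitive hx hy)]
  simp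
  ring

/-- In the application the two linear sums are the traces of the two matrices, which a
trace-preserving map leaves unchanged. -/
theorem integral_sum_log_kernel {μ : Type*} [Fintype μ] (p x y : μ → ℝ) (hx : ∀ i, 0 < x i)
    (hy : ∀ i, 0 < y i) :
    IntegrableOn (fun t : ℝ => (∑ i, p i * ((y i - x i) ^ 2 / (y i + t * x i))) *
        ((1 + t) ^ 2)⁻¹) (Set.Ioi 0) ∧
      ∫ t in Set.Ioi (0 : ℝ), (∑ i, p i * ((y i - x i) ^ 2 / (y i + t * x i))) *
        ((1 + t) ^ 2)⁻¹ = ∑ i, p i * (x i * (Real.log (x i) - Real.log (y i))) -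
          ∑ i, p i * x i + ∑ i, p i * y i := by
  simp only [Finset.sum_mul, mul_assoc]
  have h : ∀ i ∈ (Finset.univ : Finset μ), IntegrableOn (fun t : ℝ =>
      p i * ((y i - x i) ^ 2 / (y i + t * x i) * ((1 + t) ^ 2)⁻¹)) (Set.Ioi 0) := fun i _ =>
    (integrableOn_log_kernel (hx i) (hy i)).const_mul (p i)
  refine ⟨integrable_finsetSum _ h, ?_⟩
  rw [integral_finsetSum _ h, ← Finset.sum_sub_distrib, ← Finset.sum_add_distrib]
  refine Finset.sum_congr rfl fun i _ => ?_
  rw [integral_const_mul, integral_log_kernel (hx i) (hy i)]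
  ring

theorem trace_conjTranspose_mul_mul {μ : Type*} [Fintype μ] (P Q : Matrix μ μ ℂ) :
    (Pᴴ * Q * P).trace = (Q * (P * Pᴴ)).trace := by
  rw [Matrix.mul_assoc, Matrix.trace_mul_comm, Matrix.mul_assoc]

theorem trace_mul_mul_conjTranspose {μ : Type*} [Fintype μ] (P Q : Matrix μ μ ℂ) :
    (P * Q * Pᴴ).trace = (Q * (Pᴴ * P)).trace := by
  rw [Matrix.mul_assoc, Matrix.trace_mul_comm, Matrix.mul_assoc]

/-! ### Data processing for the relative entropy -/

section Quad

variable {ι κ : Type*} [Fintype ι] [DecidableEq ι] [Fintype κ] [DecidableEq κ]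

/-- The quadratic functional whose supremum over `A` is the value at `τ - ρ` of the quadratic form
of the inverse of `A ↦ τ A + t A ρ`. -/
noncomputable def divergenceQuad (t : ℝ) (ρ τ A : Matrix ι ι ℂ) : ℝ :=
  2 * (Aᴴ * (τ - ρ)).trace.re - (Aᴴ * τ * A).trace.re - t * (A * ρ * Aᴴ).trace.re

/-- The weights are the squared overlaps of the two eigenbases; `i.1` labels columns of `V` and
`i.2` columns of `U`. -/
theorem trace_mul_conj_diagonal {U V : Matrix ι ι ℂ} (x y : ι → ℝ) :
    (U * Matrix.diagonal (fun i => (x i : ℂ)) * Uᴴ *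
      (V * Matrix.diagonal (fun i => (y i : ℂ)) * Vᴴ)).trace.re =
      ∑ i : ι × ι, Complex.normSq ((Vᴴ * U) i.1 i.2) * (x i.2 * y i.1) := by
  have : (U * Matrix.diagonal (fun i => (x i : ℂ)) * Uᴴ *
      (V * Matrix.diagonal (fun i => (y i : ℂ)) * Vᴴ)).trace =
      (Matrix.diagonal (fun i => (x i : ℂ)) * ((Vᴴ * U)ᴴ *
        Matrix.diagonal (fun i => (y i : ℂ))) * (Vᴴ * U)).trace := by
    rw [Matrix.conjTranspose_mul, Matrix.conjTranspose_conjTranspose]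
    simp only [Matrix.mul_assoc]
    rw [Matrix.trace_mul_comm]
    simp only [Matrix.mul_assoc]
  rw [this, Fintype.sum_prod_type_right]
  simp only [Matrix.trace, Matrix.diag, Matrix.mul_apply (M := _ * (_ * _)),
    Matrix.diagonal_mul, Matrix.mul_diagonal, Matrix.conjTranspose_apply, Complex.re_sum]
  refine Finset.sum_congr rfl fun i _ => Finset.sum_congr rfl fun j _ => ?_
  simp [Complex.normSq_apply]
  ring

/-- The superoperator `A ↦ τ A + t A ρ` is diagonal in the matrix units formed from the two
eigenbases, so the functional decouples into one scalar quadratic per entry of `α`. -/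
theorem divergenceQuad_conj {U V : Matrix ι ι ℂ} (hU : Uᴴ * U = 1) (hV : Vᴴ * V = 1)
    (x y : ι → ℝ) (t : ℝ) (α : Matrix ι ι ℂ) :
    divergenceQuad t (U * Matrix.diagonal (fun i => (x i : ℂ)) * Uᴴ)
      (V * Matrix.diagonal (fun i => (y i : ℂ)) * Vᴴ) (V * α * Uᴴ) =
      ∑ i : ι × ι, (2 * (y i.1 - x i.2) * (star (α i.1 i.2) * (Vᴴ * U) i.1 i.2).re -
        (y i.1 + t * x i.2) * Complex.normSq (α i.1 i.2)) := by
  have hU' : ∀ M : Matrix ι ι ℂ, Uᴴ * (U * M) = M := fun M => by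
    rw [← Matrix.mul_assoc, hU, Matrix.one_mul]
  have hV' : ∀ M : Matrix ι ι ℂ, Vᴴ * (V * M) = M := fun M => by
    rw [← Matrix.mul_assoc, hV, Matrix.one_mul]
  set X := Matrix.diagonal (fun i => (x i : ℂ)) with hX
  set Y := Matrix.diagonal (fun i => (y i : ℂ)) with hY
  have e1 : ((V * α * Uᴴ)ᴴ * (V * Y * Vᴴ - U * X * Uᴴ)).trace =
      (αᴴ * (Y * (Vᴴ * U) - (Vᴴ * U) * X)).trace := by
    simp only [Matrix.conjTranspose_mul, Matrix.conjTranspose_conjTranspose, Matrix.mul_sub,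
      Matrix.mul_assoc, hV', Matrix.trace_sub]
    rw [Matrix.trace_mul_comm, Matrix.trace_mul_comm U]
    simp only [Matrix.mul_assoc, hU, Matrix.mul_one]
  have e2 : ((V * α * Uᴴ)ᴴ * (V * Y * Vᴴ) * (V * α * Uᴴ)).trace = (αᴴ * (Y * α)).trace := by
    simp only [Matrix.conjTranspose_mul, Matrix.conjTranspose_conjTranspose, Matrix.mul_assoc, hV']
    rw [Matrix.trace_mul_comm]
    simp only [Matrix.mul_assoc, hU, Matrix.mul_one]
  have e3 : ((V * α * Uᴴ) * (U * X * Uᴴ) * (V * α * Uᴴ)ᴴ).trace = (α * X * αᴴ).trace := by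
    simp only [Matrix.conjTranspose_mul, Matrix.conjTranspose_conjTranspose, Matrix.mul_assoc, hU']
    rw [Matrix.trace_mul_comm]
    simp only [Matrix.mul_assoc, hV, Matrix.mul_one]
  rw [divergenceQuad, e1, e2, e3, Matrix.trace_mul_comm (α * X), hX, hY]
  simp only [Matrix.trace, Matrix.diag, Matrix.mul_apply (M := αᴴ), Matrix.sub_apply,
    Matrix.diagonal_mul, Matrix.mul_diagonal, Matrix.conjTranspose_apply, Complex.re_sum]
  rw [Fintype.sum_prod_type_right, Finset.mul_sum, Finset.mul_sum, ← Finset.sum_sub_distrib,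
    ← Finset.sum_sub_distrib]
  refine Finset.sum_congr rfl fun i _ => ?_
  rw [Finset.mul_sum, Finset.mul_sum, ← Finset.sum_sub_distrib, ← Finset.sum_sub_distrib]
  refine Finset.sum_congr rfl fun j _ => ?_
  simp [Complex.normSq_apply]
  ring

/-- Completing the square: the defect is `|r a - c z|² / r`, which vanishes at `a = (c / r) z`. -/
theorem quadratic_le_div (c r : ℝ) (hr : 0 < r) (a z : ℂ) :
    2 * c * (star a * z).re - r * Complex.normSq a ≤ Complex.normSq z * (c ^ 2 / r) := by
  have h := Complex.normSq_nonneg ((r : ℂ) * a - c * z)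
  have h2 : Complex.normSq z * (c ^ 2 / r) - (2 * c * (star a * z).re - r * Complex.normSq a) =
      Complex.normSq ((r : ℂ) * a - c * z) / r := by
    simp [Complex.normSq_apply]
    field_simp
    ring
  have := div_nonneg h hr.le
  linarith

theorem quadratic_eq_div (c r : ℝ) (hr : 0 < r) (z : ℂ) :
    2 * c * (star (((c / r : ℝ) : ℂ) * z) * z).re -
      r * Complex.normSq (((c / r : ℝ) : ℂ) * z) = Complex.normSq z * (c ^ 2 / r) := by
  rw [Complex.normSq_mul, Complex.normSq_ofReal, star_mul]
  simp [Complex.normSq_apply]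
  field_simp
  ring

/-- The spectral form of the relative entropy of two positive definite matrices and of the suprema
of the associated quadratic functionals. -/
theorem exists_spectral_pair {ρ τ : Matrix ι ι ℂ} (hρ : ρ.PosDef) (hτ : τ.PosDef) :
    ∃ p x y : ι × ι → ℝ, (∀ i, 0 < x i) ∧ (∀ i, 0 < y i) ∧
      ∑ i, p i * x i = ρ.trace.re ∧ ∑ i, p i * y i = τ.trace.re ∧
      (ρ * (cfc Real.log ρ - cfc Real.log τ)).trace.re =
        ∑ i, p i * (x i * (Real.log (x i) - Real.log (y i))) ∧
      ∀ t : ℝ, 0 < t → IsGreatest (Set.range (divergenceQuad t ρ τ))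
        (∑ i, p i * ((y i - x i) ^ 2 / (y i + t * x i))) := by
  set U : Matrix ι ι ℂ := (hρ.1.eigenvectorUnitary : Matrix ι ι ℂ) with hUdef
  set V : Matrix ι ι ℂ := (hτ.1.eigenvectorUnitary : Matrix ι ι ℂ) with hVdef
  have hU : Uᴴ * U = 1 := Unitary.coe_star_mul_self hρ.1.eigenvectorUnitary
  have hU' : U * Uᴴ = 1 := Unitary.coe_mul_star_self hρ.1.eigenvectorUnitary
  have hV : Vᴴ * V = 1 := Unitary.coe_star_mul_self hτ.1.eigenvectorUnitary
  have hV' : V * Vᴴ = 1 := Unitary.coe_mul_star_self hτ.1.eigenvectorUnitary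
  set x := hρ.1.eigenvalues with hx
  set y := hτ.1.eigenvalues with hy
  have sρ : ρ = U * Matrix.diagonal (fun i => (x i : ℂ)) * Uᴴ := hρ.1.spectral_theorem
  have sτ : τ = V * Matrix.diagonal (fun i => (y i : ℂ)) * Vᴴ := hτ.1.spectral_theorem
  have lρ : cfc Real.log ρ = U * Matrix.diagonal (fun i => ((Real.log (x i) : ℝ) : ℂ)) * Uᴴ :=
    hρ.1.cfc_eq _
  have lτ : cfc Real.log τ = V * Matrix.diagonal (fun i => ((Real.log (y i) : ℝ) : ℂ)) * Vᴴ :=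
    hτ.1.cfc_eq _
  have oneU : U * Matrix.diagonal (fun _ => ((1 : ℝ) : ℂ)) * Uᴴ = 1 := by simp [hU']
  have oneV : V * Matrix.diagonal (fun _ => ((1 : ℝ) : ℂ)) * Vᴴ = 1 := by simp [hV']
  have xpos : ∀ i, 0 < x i := hρ.eigenvalues_pos
  have ypos : ∀ i, 0 < y i := hτ.eigenvalues_pos
  refine ⟨fun i => Complex.normSq ((Vᴴ * U) i.1 i.2), fun i => x i.2, fun i => y i.1,
    fun i => xpos _, fun i => ypos _, ?_, ?_, ?_, fun t ht => ⟨?_, ?_⟩⟩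
  · have := trace_mul_conj_diagonal (U := U) (V := V) x (fun _ => 1)
    rw [oneV, Matrix.mul_one, ← sρ] at this
    simp [this]
  · have := trace_mul_conj_diagonal (U := U) (V := V) (fun _ => 1) y
    rw [oneU, Matrix.one_mul, ← sτ] at this
    simp [this]
  · have h1 := trace_mul_conj_diagonal (U := U) (V := V) (fun i => x i * Real.log (x i))
      (fun _ => 1)
    have h2 := trace_mul_conj_diagonal (U := U) (V := V) x (fun i => Real.log (y i))
    rw [← sρ, ← lτ] at h2
    have h3 : ρ * cfc Real.log ρ =
        U * Matrix.diagonal (fun i => ((x i * Real.log (x i) : ℝ) : ℂ)) * Uᴴ := by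
      rw [lρ]
      nth_rw 1 [sρ]
      simp only [Matrix.mul_assoc]
      rw [← Matrix.mul_assoc Uᴴ U, hU, Matrix.one_mul, ← Matrix.mul_assoc (Matrix.diagonal _),
        Matrix.diagonal_mul_diagonal]
      simp
    rw [oneV, Matrix.mul_one, ← h3] at h1
    rw [Matrix.mul_sub, Matrix.trace_sub, Complex.sub_re, h1, h2, ← Finset.sum_sub_distrib]
    refine Finset.sum_congr rfl fun i _ => ?_
    ring
  -- The maximiser is the entrywise one from completing the square, with `c = y i - x j` and `r = y
  -- i + t * x j`.
  · let α : Matrix ι ι ℂ := Matrix.of fun i j =>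
      (((y i - x j) / (y i + t * x j) : ℝ) : ℂ) * (Vᴴ * U) i j
    refine ⟨V * α * Uᴴ, ?_⟩
    rw [sρ, sτ, divergenceQuad_conj hU hV]
    refine Finset.sum_congr rfl fun i _ => ?_
    exact quadratic_eq_div _ _ (add_pos (ypos _) (mul_pos ht (xpos _))) _
  · rintro _ ⟨A, rfl⟩
    have hA : A = V * (Vᴴ * A * U) * Uᴴ := by
      simp only [Matrix.mul_assoc, hU', Matrix.mul_one]
      rw [← Matrix.mul_assoc, hV', Matrix.one_mul]
    rw [hA, sρ, sτ, divergenceQuad_conj hU hV]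
    refine Finset.sum_le_sum fun i _ => ?_
    exact quadratic_le_div _ _ (add_pos (ypos _) (mul_pos ht (xpos _))) _ _

/-- The map with Kraus operators `K`. -/
def krausMap {η : Type*} [Fintype η] (K : η → Matrix κ ι ℂ) (ρ : Matrix ι ι ℂ) : Matrix κ κ ℂ :=
  ∑ m, K m * ρ * (K m)ᴴ

omit [DecidableEq ι] [DecidableEq κ] in
theorem trace_krausMap_mul {η : Type*} [Fintype η] (K : η → Matrix κ ι ℂ) (ρ : Matrix ι ι ℂ)
    (B : Matrix κ κ ℂ) :
    (krausMap K ρ * B).trace = (ρ * ∑ m, (K m)ᴴ * B * K m).trace := by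
  simp only [krausMap, Finset.sum_mul, Finset.mul_sum, Matrix.trace_sum]
  refine Finset.sum_congr rfl fun m _ => ?_
  rw [Matrix.mul_assoc, Matrix.mul_assoc, Matrix.trace_mul_comm]
  simp only [Matrix.mul_assoc]

theorem trace_krausMap {η : Type*} [Fintype η] {K : η → Matrix κ ι ℂ}
    (hK : ∑ m, (K m)ᴴ * K m = 1) (ρ : Matrix ι ι ℂ) : (krausMap K ρ).trace = ρ.trace := by
  have := trace_krausMap_mul K ρ 1
  simpa [hK] using this

omit [DecidableEq κ] in
/-- The Kadison–Schwarz inequality for the dual of a trace-preserving Kraus map, paired with a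
positive semidefinite matrix. -/
theorem trace_schwarz {η : Type*} [Fintype η] {K : η → Matrix κ ι ℂ}
    (hK : ∑ m, (K m)ᴴ * K m = 1) {ρ : Matrix ι ι ℂ} (hρ : ρ.PosSemidef) (B : Matrix κ κ ℂ) :
    (ρ * ((∑ m, (K m)ᴴ * B * K m) * (∑ m, (K m)ᴴ * B * K m)ᴴ)).trace.re ≤
      (krausMap K ρ * (B * Bᴴ)).trace.re := by
  set A := ∑ m, (K m)ᴴ * B * K m with hA
  have hA' : Aᴴ = ∑ m, (K m)ᴴ * Bᴴ * K m := by
    rw [hA, Matrix.conjTranspose_sum]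
    simp only [Matrix.conjTranspose_mul, Matrix.conjTranspose_conjTranspose, Matrix.mul_assoc]
  -- The Schwarz defect is a sum of squares; the last of the expanded terms collapses to `A * Aᴴ` by
  -- trace preservation.
  have key : ∑ m, (Bᴴ * K m - K m * Aᴴ)ᴴ * (Bᴴ * K m - K m * Aᴴ) =
      ∑ m, (K m)ᴴ * (B * Bᴴ) * K m - A * Aᴴ := by
    have h1 : ∀ m, (Bᴴ * K m - K m * Aᴴ)ᴴ * (Bᴴ * K m - K m * Aᴴ) =
        (K m)ᴴ * (B * Bᴴ) * K m - ((K m)ᴴ * B * K m) * Aᴴ - A * ((K m)ᴴ * Bᴴ * K m) +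
          A * ((K m)ᴴ * K m) * Aᴴ := fun m => by
      simp only [Matrix.conjTranspose_sub, Matrix.conjTranspose_mul,
        Matrix.conjTranspose_conjTranspose, Matrix.mul_sub, Matrix.sub_mul, Matrix.mul_assoc]
      abel
    simp only [h1, Finset.sum_add_distrib, Finset.sum_sub_distrib, ← Finset.sum_mul,
      ← Finset.mul_sum, ← hA, ← hA', hK]
    simp
  rw [trace_krausMap_mul, ← sub_nonneg, ← Complex.sub_re, ← Matrix.trace_sub, ← Matrix.mul_sub,
    ← key, Finset.mul_sum, Matrix.trace_sum, Complex.re_sum]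
  refine Finset.sum_nonneg fun m _ => ?_
  rw [← Matrix.mul_assoc, Matrix.trace_mul_comm, ← Matrix.mul_assoc]
  exact (Complex.le_def.1 (hρ.mul_mul_conjTranspose_same _).trace_nonneg).1

/-- Pulling the trial matrix back by the dual map keeps the linear term, by duality, and does not
increase the two subtracted quadratic terms, by Schwarz applied to `B` and to `Bᴴ`. Taking suprema
over trial matrices gives monotonicity for each `t`. -/
theorem divergenceQuad_krausMap_le {η : Type*} [Fintype η] {K : η → Matrix κ ι ℂ}
    (hK : ∑ m, (K m)ᴴ * K m = 1) {ρ τ : Matrix ι ι ℂ} (hρ : ρ.PosSemidef) (hτ : τ.PosSemidef)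
    {t : ℝ} (ht : 0 ≤ t) (B : Matrix κ κ ℂ) :
    divergenceQuad t (krausMap K ρ) (krausMap K τ) B ≤
      divergenceQuad t ρ τ (∑ m, (K m)ᴴ * B * K m) := by
  set A := ∑ m, (K m)ᴴ * B * K m with hA
  have hA' : Aᴴ = ∑ m, (K m)ᴴ * Bᴴ * K m := by
    rw [hA, Matrix.conjTranspose_sum]
    simp only [Matrix.conjTranspose_mul, Matrix.conjTranspose_conjTranspose, Matrix.mul_assoc]
  have h1 := trace_schwarz hK hτ B
  have h2 := trace_schwarz hK hρ Bᴴ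
  rw [← hA] at h1
  rw [← hA', Matrix.conjTranspose_conjTranspose, Matrix.conjTranspose_conjTranspose] at h2
  have h3 : (Bᴴ * (krausMap K τ - krausMap K ρ)).trace = (Aᴴ * (τ - ρ)).trace := by
    rw [Matrix.trace_mul_comm, Matrix.trace_mul_comm Aᴴ, Matrix.sub_mul, Matrix.trace_sub,
      trace_krausMap_mul, trace_krausMap_mul, ← hA', Matrix.sub_mul, Matrix.trace_sub]
  have h4 := mul_le_mul_of_nonneg_left h2 ht
  rw [divergenceQuad, divergenceQuad, h3, trace_conjTranspose_mul_mul, trace_conjTranspose_mul_mul,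
    trace_mul_mul_conjTranspose, trace_mul_mul_conjTranspose]
  linarith

/-- The data processing inequality for positive definite matrices. -/
theorem relEnt_krausMap_le {η : Type*} [Fintype η] {K : η → Matrix κ ι ℂ}
    (hK : ∑ m, (K m)ᴴ * K m = 1) {ρ τ : Matrix ι ι ℂ} (hρ : ρ.PosDef) (hτ : τ.PosDef)
    (hρ' : (krausMap K ρ).PosDef) (hτ' : (krausMap K τ).PosDef) :
    (krausMap K ρ * (cfc Real.log (krausMap K ρ) - cfc Real.log (krausMap K τ))).trace.re ≤
      (ρ * (cfc Real.log ρ - cfc Real.log τ)).trace.re := by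
  obtain ⟨p, x, y, hx, hy, sx, sy, D, F⟩ := exists_spectral_pair hρ hτ
  obtain ⟨p', x', y', hx', hy', sx', sy', D', F'⟩ := exists_spectral_pair hρ' hτ'
  obtain ⟨i1, e1⟩ := integral_sum_log_kernel p x y hx hy
  obtain ⟨i2, e2⟩ := integral_sum_log_kernel p' x' y' hx' hy'
  -- The supremum on the output side is attained at some `B`, whose pullback is a trial matrix on
  -- the input side.
  have key := setIntegral_mono_on i2 i1 measurableSet_Ioi fun t ht => by
    obtain ⟨B, hB⟩ := (F' t ht).1
    rw [← hB]
    refine mul_le_mul_of_nonneg_right ?_ (by positivity)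
    exact (divergenceQuad_krausMap_le hK hρ.posSemidef hτ.posSemidef (le_of_lt ht) B).trans
      ((F t ht).2 ⟨_, rfl⟩)
  rw [e1, e2, sx, sy, sx', sy', ← D, ← D', trace_krausMap hK, trace_krausMap hK] at key
  linarith

end Quad

end LogKernel

/-! ### Fisher information along a projection -/

section Projection

variable {ι : Type*} [Fintype ι] [DecidableEq ι]

theorem exp_smul_of_isIdempotentElem {H : Matrix ι ι ℂ} (hH : H * H = H) (z : ℂ) :
    NormedSpace.exp (z • H) = 1 + (Complex.exp z - 1) • H := by
  have hpow : ∀ k : ℕ, H ^ (k + 1) = H := fun k => by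
    induction k with
    | zero => simp
    | succ k ih => rw [pow_succ, ih, hH]
  have h1 : HasSum (fun k : ℕ => ((k.factorial : ℂ)⁻¹ * z ^ k) • H) (Complex.exp z • H) := by
    have := NormedSpace.exp_series_hasSum_exp' (𝕂 := ℂ) z
    rw [← Complex.exp_eq_exp_ℂ] at this
    simpa [smul_eq_mul] using this.smul_const H
  have h2 : HasSum (fun k : ℕ => if k = 0 then 1 - H else 0) (1 - H) := hasSum_ite_eq 0 _
  have h3 := h1.add h2
  have h4 : (fun k : ℕ => (k.factorial : ℂ)⁻¹ • (z • H) ^ k) =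
      fun k : ℕ => ((k.factorial : ℂ)⁻¹ * z ^ k) • H + if k = 0 then 1 - H else 0 := by
    funext k
    rcases k with _ | k
    · simp
    · simp [smul_pow, hpow, smul_smul]
  rw [NormedSpace.exp_eq_tsum ℂ]
  refine (HasSum.tsum_eq ?_).trans (b := Complex.exp z • H + (1 - H)) ?_
  · rw [h4]
    exact h3
  · rw [sub_smul, one_smul]
    abel

/-- The unitary family generated by a projection, in closed form. -/
theorem unitaryFamily_of_isIdempotentElem {H : Matrix ι ι ℂ} (hH : H * H = H)
    (ρ : Matrix ι ι ℂ) (θ : ℝ) :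
    unitaryFamily ρ H θ =
      (1 + (Complex.exp (Complex.I * θ) - 1) • H) * ρ *
        (1 + (Complex.exp (-(Complex.I * θ)) - 1) • H) := by
  rw [unitaryFamily, exp_smul_of_isIdempotentElem hH, exp_smul_of_isIdempotentElem hH]

theorem phase_mul_phase {H : Matrix ι ι ℂ} (hH : H * H = H) (z : ℂ) :
    (1 + (Complex.exp z - 1) • H) * (1 + (Complex.exp (-z) - 1) • H) = 1 := by
  have : (Complex.exp z - 1) * (Complex.exp (-z) - 1) =
      -((Complex.exp z - 1) + (Complex.exp (-z) - 1)) := by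
    have := Complex.exp_add z (-z)
    rw [add_neg_cancel, Complex.exp_zero] at this
    linear_combination -this
  rw [Matrix.mul_add, Matrix.add_mul, Matrix.add_mul, smul_mul_smul_comm, hH, this, neg_smul, add_smul]
  simp only [Matrix.one_mul, Matrix.mul_one]
  abel

omit [Fintype ι] in
theorem conjTranspose_phase {H : Matrix ι ι ℂ} (hH : Hᴴ = H) (θ : ℝ) :
    (1 + (Complex.exp (Complex.I * θ) - 1) • H)ᴴ =
      1 + (Complex.exp (-(Complex.I * θ)) - 1) • H := by
  rw [Matrix.conjTranspose_add, Matrix.conjTranspose_smul, hH]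
  simp [← Complex.exp_conj]

theorem posDef_unitary_conj {V ρ : Matrix ι ι ℂ} (hV : Vᴴ * V = 1) (hρ : ρ.PosDef) :
    (V * ρ * Vᴴ).PosDef := by
  refine hρ.mul_mul_conjTranspose_same ?_
  intro a b hab
  have := congrArg (fun w => w ᵥ* Vᴴ) hab
  have hV' := mul_eq_one_comm.1 hV
  simpa [Matrix.vecMul_vecMul, hV'] using this

theorem cfc_conj (f : ℝ → ℝ) {V ρ : Matrix ι ι ℂ} (hV : Vᴴ * V = 1) (hρ : ρ.IsHermitian) :
    cfc f (V * ρ * Vᴴ) = V * cfc f ρ * Vᴴ := by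
  have hV' := mul_eq_one_comm.1 hV
  let u : unitary (Matrix ι ι ℂ) := ⟨V, hV, hV'⟩
  have h1 : IsSelfAdjoint ρ := hρ
  have h2 : IsSelfAdjoint (V * ρ * Vᴴ) := Matrix.isHermitian_mul_mul_conjTranspose V hρ
  -- The spectrum is finite, so every function is continuous on it, including `Real.log` if `0`
  -- belongs to it.
  have hf : ContinuousOn f (spectrum ℝ ρ) := (Matrix.finite_real_spectrum).continuousOn f
  exact (StarAlgHomClass.map_cfc (S := ℂ) (Unitary.conjStarAlgAut ℂ _ u) f ρ hf
    (show Continuous fun M : Matrix ι ι ℂ => V * M * Vᴴ by fun_prop) h1 h2).symm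

theorem relEntropy_of_posDef (ρ : Matrix ι ι ℂ) {τ : Matrix ι ι ℂ} (hτ : τ.PosDef) :
    relEntropy ρ τ = ((ρ * (cfc Real.log ρ - cfc Real.log τ)).trace.re : ℝ) := by
  rw [relEntropy, if_pos]
  intro v hv
  have : v = 0 := Matrix.mulVec_injective_of_isUnit hτ.isUnit (hv.trans (Matrix.mulVec_zero τ).symm)
  simp [this]

theorem iteratedDeriv_two_trig (a b c : ℝ) :
    iteratedDeriv 2 (fun θ : ℝ => a + b * Real.cos θ + c * Real.sin θ) 0 = -b := by
  have h1 : deriv (fun θ : ℝ => a + b * Real.cos θ + c * Real.sin θ) =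
      fun θ => -(b * Real.sin θ) + c * Real.cos θ := by
    ext θ
    rw [((((Real.hasDerivAt_cos θ).const_mul b).const_add a).fun_add
      ((Real.hasDerivAt_sin θ).const_mul c)).deriv]
    ring
  have h2 : HasDerivAt (fun θ : ℝ => -(b * Real.sin θ) + c * Real.cos θ) (-b) 0 := by
    have := ((Real.hasDerivAt_sin 0).const_mul b).fun_neg.fun_add ((Real.hasDerivAt_cos 0).const_mul c)
    simpa using this
  rw [iteratedDeriv_succ, iteratedDeriv_one, h1, h2.deriv]

/-- The Fisher information of a positive definite matrix along a projection. -/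
theorem fisherInfoAlong_of_posDef {ρ H : Matrix ι ι ℂ} (hρ : ρ.PosDef) (hH : H * H = H)
    (hH' : Hᴴ = H) :
    fisherInfoAlong ρ H =
      ((2 * ((ρ * (H * cfc Real.log ρ)).trace.re - (ρ * (H * cfc Real.log ρ * H)).trace.re) : ℝ) :
        EReal) := by
  set L := cfc Real.log ρ with hL
  have h0 : unitaryFamily ρ H 0 = ρ := by simp [unitaryFamily_of_isIdempotentElem hH]
  have hpd : ∀ θ, (unitaryFamily ρ H θ).PosDef ∧
      cfc Real.log (unitaryFamily ρ H θ) = (1 + (Complex.exp (Complex.I * θ) - 1) • H) * L *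
        (1 + (Complex.exp (-(Complex.I * θ)) - 1) • H) := by
    intro θ
    have hV : (1 + (Complex.exp (Complex.I * θ) - 1) • H)ᴴ *
        (1 + (Complex.exp (Complex.I * θ) - 1) • H) = 1 := by
      rw [conjTranspose_phase hH']
      exact mul_eq_one_comm.1 (phase_mul_phase hH _)
    rw [unitaryFamily_of_isIdempotentElem hH, ← conjTranspose_phase hH' θ]
    exact ⟨posDef_unitary_conj hV hρ, cfc_conj _ hV hρ.1⟩
  have hrel : ∀ θ, relEntropy (unitaryFamily ρ H 0) (unitaryFamily ρ H θ) =
      ((ρ * (L - (1 + (Complex.exp (Complex.I * θ) - 1) • H) * L *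
        (1 + (Complex.exp (-(Complex.I * θ)) - 1) • H))).trace.re : ℝ) := fun θ => by
    rw [relEntropy_of_posDef _ (hpd θ).1, (hpd θ).2, h0]
  have hLH : IsSelfAdjoint L := cfc_predicate _ _
  -- The two first-order terms are complex conjugates, so together they contribute only through
  -- `w.re` and `w.im`.
  have hflip : (ρ * (L * H)).trace = star (ρ * (H * L)).trace := by
    rw [← Matrix.trace_conjTranspose, Matrix.conjTranspose_mul, Matrix.conjTranspose_mul, hH',
      hρ.1.eq, show Lᴴ = L from hLH, Matrix.trace_mul_comm]
  rw [fisherInfoAlong, familyFisherInfo, if_pos (by simp [hrel])]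
  simp only [hrel, EReal.toReal_coe]
  set w := (ρ * (H * L)).trace with hw
  set q := (ρ * (H * L * H)).trace with hq
  -- With `z = exp(iθ) - 1`, the coefficient of `H * L * H` is `|z|² = 2 - 2 cos θ`, so only first
  -- harmonics occur.
  have hfun : (fun θ : ℝ => (ρ * (L - (1 + (Complex.exp (Complex.I * θ) - 1) • H) * L *
        (1 + (Complex.exp (-(Complex.I * θ)) - 1) • H))).trace.re) =
      fun θ => (2 * w.re - 2 * q.re) + (-(2 * w.re - 2 * q.re)) * Real.cos θ +
        (2 * w.im) * Real.sin θ := by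
    ext θ
    have e : L - (1 + (Complex.exp (Complex.I * θ) - 1) • H) * L *
        (1 + (Complex.exp (-(Complex.I * θ)) - 1) • H) =
        -((Complex.exp (Complex.I * θ) - 1) • (H * L) +
          (Complex.exp (-(Complex.I * θ)) - 1) • (L * H) +
          ((Complex.exp (Complex.I * θ) - 1) * (Complex.exp (-(Complex.I * θ)) - 1)) •
            (H * L * H)) := by
      simp only [Matrix.add_mul, Matrix.mul_add, Matrix.one_mul, Matrix.mul_one, Matrix.smul_mul,
        Matrix.mul_smul]
      rw [smul_add, smul_smul, mul_comm (Complex.exp (-(Complex.I * θ)) - 1)]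
      abel
    have c1 : Complex.exp (Complex.I * θ) = ⟨Real.cos θ, Real.sin θ⟩ := by
      apply Complex.ext <;> simp [Complex.exp_re, Complex.exp_im]
    have c2 : Complex.exp (-(Complex.I * θ)) = ⟨Real.cos θ, -Real.sin θ⟩ := by
      apply Complex.ext <;> simp [Complex.exp_re, Complex.exp_im]
    rw [e, Matrix.mul_neg, Matrix.trace_neg, Matrix.mul_add, Matrix.mul_add, Matrix.mul_smul,
      Matrix.mul_smul, Matrix.mul_smul, Matrix.trace_add, Matrix.trace_add, Matrix.trace_smul,
      Matrix.trace_smul, Matrix.trace_smul, hflip, ← hw, ← hq, c1, c2]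
    have := Real.sin_sq_add_cos_sq θ
    simp
    linear_combination (-q.re) * this
  rw [hfun, iteratedDeriv_two_trig]
  congr 1
  ring

/-- If the Fisher information along a projection is finite, the projection preserves the kernel. -/
theorem mulVec_eq_zero_of_fisherInfoAlong_ne_top {ρ H : Matrix ι ι ℂ} (hH : H * H = H)
    (h : fisherInfoAlong ρ H ≠ ⊤) {v : ι → ℂ} (hv : ρ *ᵥ v = 0) : ρ *ᵥ (H *ᵥ v) = 0 := by
  have h0 : unitaryFamily ρ H 0 = ρ := by simp [unitaryFamily_of_isIdempotentElem hH]
  rw [fisherInfoAlong, familyFisherInfo] at h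
  split_ifs at h with hev
  swap
  · exact absurd rfl h
  -- Restricting to `0 < θ < π` makes `exp(iθ) - 1` nonzero, its imaginary part being `sin θ > 0`.
  have hev' := (hev.filter_mono nhdsWithin_le_nhds).and (Ioo_mem_nhdsGT Real.pi_pos)
  obtain ⟨θ, hθ, hθ0, hθ1⟩ := hev'.exists
  rw [relEntropy, h0] at hθ
  split_ifs at hθ with hker
  swap
  · exact absurd rfl hθ
  -- The kernel of the rotated state is the rotated kernel; support inclusion then places `v +
  -- (exp(iθ) - 1) H v` in `ker ρ`.
  have h1 : unitaryFamily ρ H θ *ᵥ ((1 + (Complex.exp (Complex.I * θ) - 1) • H) *ᵥ v) = 0 := by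
    have := phase_mul_phase hH (-(Complex.I * θ))
    rw [neg_neg] at this
    rw [unitaryFamily_of_isIdempotentElem hH, Matrix.mulVec_mulVec, Matrix.mul_assoc, this,
      Matrix.mul_one, ← Matrix.mulVec_mulVec, hv, Matrix.mulVec_zero]
  have h2 := hker _ h1
  rw [Matrix.add_mulVec, Matrix.one_mulVec, Matrix.mulVec_add, hv, zero_add, Matrix.smul_mulVec,
    Matrix.mulVec_smul] at h2
  refine (smul_eq_zero.1 h2).resolve_left fun hc => ?_
  have := congrArg Complex.im hc
  simp [Complex.exp_im] at this
  exact (Real.sin_pos_of_pos_of_lt_pi hθ0 hθ1).ne' this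

theorem fisherInfoAlong_ne_bot (ρ H : Matrix ι ι ℂ) : fisherInfoAlong ρ H ≠ ⊥ := by
  rw [fisherInfoAlong, familyFisherInfo]
  split_ifs <;> simp

end Projection

/-! ### Finite sums in the extended reals -/

theorem ereal_sum_ne_bot {α : Type*} {s : Finset α} {f : α → EReal} (hf : ∀ i ∈ s, f i ≠ ⊥) :
    ∑ i ∈ s, f i ≠ ⊥ :=
  Finset.sum_induction f (· ≠ ⊥) (fun _ _ ha hb => by simp [EReal.add_eq_bot_iff, ha, hb])
    (by simp) hf

/-- Excluding `⊥` is essential, because `⊤ + ⊥ = ⊥` in `EReal` would hide an infinite summand. -/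
theorem ereal_ne_top_of_sum_ne_top {α : Type*} {s : Finset α} {f : α → EReal}
    (hf : ∀ i ∈ s, f i ≠ ⊥) (h : ∑ i ∈ s, f i ≠ ⊤) {i : α} (hi : i ∈ s) : f i ≠ ⊤ := by
  classical
  rw [← Finset.add_sum_erase s f hi, EReal.add_ne_top_iff_ne_top₂ (hf i hi)
    (ereal_sum_ne_bot fun j hj => hf j (Finset.mem_of_mem_erase hj))] at h
  exact h.1

theorem ereal_coe_sum {α : Type*} (s : Finset α) (f : α → ℝ) :
    ((∑ i ∈ s, f i : ℝ) : EReal) = ∑ i ∈ s, (f i : EReal) := by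
  classical
  induction s using Finset.induction_on with
  | empty => simp
  | insert a s ha ih => rw [Finset.sum_insert ha, Finset.sum_insert ha, EReal.coe_add, ih]

/-! ### Spectral projections of unitary representations of `ℤ_d` -/

section Spectral

variable {d : ℕ} [NeZero d] {ι : Type*} [Fintype ι] [DecidableEq ι]

/-- A unitary representation of `ℤ_d` by matrices. -/
structure IsUnitaryRep (W : ZMod d → Matrix ι ι ℂ) : Prop where
  zero : W 0 = 1
  add : ∀ a b, W (a + b) = W a * W b
  star : ∀ a, (W a)ᴴ = W (-a)

/-- The spectral projection of a representation of `ℤ_d` at the character `j`. -/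
noncomputable def spectralProj (W : ZMod d → Matrix ι ι ℂ) (j : ZMod d) : Matrix ι ι ℂ :=
  (d : ℂ)⁻¹ • ∑ a, (ZMod.stdAddChar (-(j * a)) : ℂ) • W a

theorem sum_stdAddChar_mul (b : ZMod d) :
    ∑ j : ZMod d, (ZMod.stdAddChar (j * b) : ℂ) = if b = 0 then (d : ℂ) else 0 := by
  rw [AddChar.sum_mulShift b (ZMod.isPrimitive_stdAddChar d), ZMod.card]
  split_ifs <;> simp

variable {W : ZMod d → Matrix ι ι ℂ}

omit [DecidableEq ι] in
-- Expanding both projections gives a double sum over `a` and `b`; character orthogonality in `j`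
-- keeps only `b = -a`. Thus pinching equals averaging over conjugations.
theorem sum_spectralProj_mul_mul (W : ZMod d → Matrix ι ι ℂ) (L : Matrix ι ι ℂ) :
    ∑ j, spectralProj W j * L * spectralProj W j = (d : ℂ)⁻¹ • ∑ a, W a * L * W (-a) := by
  have hd : (d : ℂ) ≠ 0 := Nat.cast_ne_zero.2 (NeZero.ne d)
  have h1 : ∀ j, spectralProj W j * L * spectralProj W j =
      ((d : ℂ)⁻¹ * (d : ℂ)⁻¹) • ∑ a, ∑ b,
        (ZMod.stdAddChar (j * (-a + -b)) : ℂ) • (W a * L * W b) := by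
    intro j
    simp only [spectralProj, Matrix.smul_mul, Matrix.mul_smul, smul_smul, Finset.sum_mul,
      Finset.mul_sum, Finset.smul_sum]
    rw [Finset.sum_comm]
    refine Finset.sum_congr rfl fun a _ => Finset.sum_congr rfl fun b _ => ?_
    rw [mul_add, mul_neg, mul_neg, AddChar.map_add_eq_mul]
    congr 1
    ring
  simp only [h1, ← Finset.smul_sum]
  rw [Finset.sum_comm, mul_smul]
  congr 1
  rw [Finset.smul_sum]
  refine Finset.sum_congr rfl fun a _ => ?_
  rw [Finset.sum_comm]
  simp only [← Finset.sum_smul, sum_stdAddChar_mul, ite_smul, zero_smul]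
  rw [Finset.sum_eq_single (-a)]
  · simp [smul_smul, hd]
  · intro b _ hb
    rw [if_neg]
    intro h
    exact hb (by linear_combination -h)
  · simp

namespace IsUnitaryRep

omit [NeZero d] in
theorem star_mul_self (hW : IsUnitaryRep W) (a : ZMod d) : (W a)ᴴ * W a = 1 := by
  rw [hW.star, ← hW.add, neg_add_cancel, hW.zero]

theorem mul_spectralProj (hW : IsUnitaryRep W) (b j : ZMod d) :
    W b * spectralProj W j = (ZMod.stdAddChar (j * b) : ℂ) • spectralProj W j := by
  rw [spectralProj, Matrix.mul_smul, smul_comm (ZMod.stdAddChar _ : ℂ)]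
  congr 1
  rw [Finset.mul_sum, Finset.smul_sum]
  refine Fintype.sum_equiv (Equiv.addLeft b) _ _ fun a => ?_
  rw [Matrix.mul_smul, Equiv.coe_addLeft, smul_smul, ← AddChar.map_add_eq_mul, ← hW.add]
  congr 2
  ring

theorem spectralProj_mul_self (hW : IsUnitaryRep W) (j : ZMod d) :
    spectralProj W j * spectralProj W j = spectralProj W j := by
  have hd : (d : ℂ) ≠ 0 := Nat.cast_ne_zero.2 (NeZero.ne d)
  nth_rw 1 [spectralProj]
  rw [Matrix.smul_mul, Finset.sum_mul]
  simp only [Matrix.smul_mul, hW.mul_spectralProj, smul_smul, ← AddChar.map_add_eq_mul,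
    neg_add_cancel, AddChar.map_zero_eq_one, one_smul]
  rw [Finset.sum_const, Finset.card_univ, ZMod.card, ← Nat.cast_smul_eq_nsmul ℂ, smul_smul,
    inv_mul_cancel₀ hd, one_smul]

theorem conjTranspose_spectralProj (hW : IsUnitaryRep W) (j : ZMod d) :
    (spectralProj W j)ᴴ = spectralProj W j := by
  rw [spectralProj, Matrix.conjTranspose_smul, Matrix.conjTranspose_sum]
  congr 1
  · simp
  · refine Fintype.sum_equiv (Equiv.neg _) _ _ fun a => ?_
    rw [Matrix.conjTranspose_smul, hW.star, Equiv.neg_apply]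
    congr 1
    rw [RCLike.star_def, ← AddChar.map_neg_eq_conj]
    congr 1
    ring

omit [Fintype ι] [DecidableEq ι] in
theorem sum_smul_spectralProj (W : ZMod d → Matrix ι ι ℂ) (b : ZMod d) :
    ∑ j, (ZMod.stdAddChar (j * b) : ℂ) • spectralProj W j = W b := by
  have hd : (d : ℂ) ≠ 0 := Nat.cast_ne_zero.2 (NeZero.ne d)
  simp only [spectralProj, Finset.smul_sum, smul_smul]
  rw [Finset.sum_comm]
  simp only [← Finset.sum_smul]
  have h : ∀ a, ∑ j, (ZMod.stdAddChar (j * b) : ℂ) * ((d : ℂ)⁻¹ * ZMod.stdAddChar (-(j * a))) =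
      if b - a = 0 then 1 else 0 := by
    intro a
    have := sum_stdAddChar_mul (b - a)
    simp only [mul_left_comm _ (d : ℂ)⁻¹, ← AddChar.map_add_eq_mul, ← Finset.mul_sum]
    have h2 : ∀ j, j * b + -(j * a) = j * (b - a) := fun j => by ring
    simp only [h2, this]
    split_ifs <;> simp [hd]
  simp only [h, sub_eq_zero, ite_smul, one_smul, zero_smul]
  simp

theorem sum_spectralProj (hW : IsUnitaryRep W) : ∑ j, spectralProj W j = 1 := by
  simpa [hW.zero] using sum_smul_spectralProj W 0

/-- The total Fisher information along the spectral projections of a unitary representation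
of `ℤ_d` is an average of relative entropies. -/
theorem sum_fisherInfoAlong (hW : IsUnitaryRep W) {ρ : Matrix ι ι ℂ} (hρ : ρ.PosDef) :
    ∑ j, fisherInfoAlong ρ (spectralProj W j) =
      ((2 * (d : ℝ)⁻¹ * ∑ a, (ρ * (cfc Real.log ρ -
        cfc Real.log (W a * ρ * (W a)ᴴ))).trace.re : ℝ) : EReal) := by
  have hd : (d : ℝ) ≠ 0 := Nat.cast_ne_zero.2 (NeZero.ne d)
  simp only [fun j => fisherInfoAlong_of_posDef hρ (hW.spectralProj_mul_self j)
    (hW.conjTranspose_spectralProj j), ← ereal_coe_sum]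
  congr 1
  have : ∀ M : Matrix ι ι ℂ, (ρ * (d : ℂ)⁻¹ • M).trace.re = (d : ℝ)⁻¹ * (ρ * M).trace.re := by
    intro M
    rw [Matrix.mul_smul, Matrix.trace_smul, ← Complex.ofReal_natCast, ← Complex.ofReal_inv,
      smul_eq_mul, Complex.re_ofReal_mul]
  have h1 : ∑ j, (ρ * (spectralProj W j * cfc Real.log ρ)).trace.re =
      (ρ * cfc Real.log ρ).trace.re := by
    rw [← Complex.re_sum, ← Matrix.trace_sum, ← Finset.mul_sum, ← Finset.sum_mul,
      hW.sum_spectralProj, Matrix.one_mul]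
  have h2 : ∑ j, (ρ * (spectralProj W j * cfc Real.log ρ * spectralProj W j)).trace.re =
      (d : ℝ)⁻¹ * ∑ a, (ρ * (W a * cfc Real.log ρ * (W a)ᴴ)).trace.re := by
    rw [← Complex.re_sum, ← Matrix.trace_sum, ← Finset.mul_sum, sum_spectralProj_mul_mul, this,
      ← Complex.re_sum, ← Matrix.trace_sum, ← Finset.mul_sum]
    simp only [hW.star]
  simp only [fun a => cfc_conj Real.log (hW.star_mul_self a) hρ.1, Matrix.mul_sub ρ,
    Matrix.trace_sub, Complex.sub_re]
  rw [← Finset.mul_sum, Finset.sum_sub_distrib, Finset.sum_sub_distrib, h1, h2, Finset.sum_const,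
    Finset.card_univ, ZMod.card, nsmul_eq_mul]
  field_simp

end IsUnitaryRep

end Spectral

/-! ### Weyl operators, their spectral projections and irreducibility -/

section Weyl

variable {d : ℕ} [NeZero d] {n : ℕ}

/-- The operator `X ^ a` on the `k`-th qudit. -/
def shiftX (k : Fin n) (a : ZMod d) : Op d n :=
  Matrix.of fun x y => if x = y + Pi.single k a then 1 else 0

/-- The operator `Z ^ a` on the `k`-th qudit. -/
noncomputable def phaseZ (k : Fin n) (a : ZMod d) : Op d n :=
  Matrix.diagonal fun x => (ZMod.stdAddChar (a * x k) : ℂ)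

theorem shiftX_mul_apply (k : Fin n) (a : ZMod d) (M : Op d n) (x y : Idx d n) :
    (shiftX k a * M) x y = M (x - Pi.single k a) y := by
  simp [shiftX, Matrix.mul_apply, ← sub_eq_iff_eq_add]

theorem isUnitaryRep_shiftX (k : Fin n) : IsUnitaryRep (shiftX (d := d) k) where
  zero := by
    ext x y
    simp [shiftX, Matrix.one_apply]
  add a b := by
    ext x y
    rw [shiftX_mul_apply]
    simp only [shiftX, Matrix.of_apply, Pi.single_add, sub_eq_iff_eq_add]
    congr 2
    abel
  star a := by
    ext x y
    simp only [shiftX, Matrix.conjTranspose_apply, Matrix.of_apply, Pi.single_neg,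
      ← sub_eq_add_neg, eq_sub_iff_add_eq, @eq_comm _ y]
    split_ifs <;> simp

theorem isUnitaryRep_phaseZ (k : Fin n) : IsUnitaryRep (phaseZ (d := d) k) where
  zero := by simp [phaseZ]
  add a b := by simp [phaseZ, add_mul, AddChar.map_add_eq_mul]
  star a := by
    simp only [phaseZ, Matrix.diagonal_conjTranspose]
    congr 1
    ext x
    rw [Pi.star_apply, RCLike.star_def, ← AddChar.map_neg_eq_conj, neg_mul]

theorem shiftX_conj_apply (k : Fin n) (a : ZMod d) (M : Op d n) (x y : Idx d n) :
    (shiftX k a * M * (shiftX k a)ᴴ) x y = M (x - Pi.single k a) (y - Pi.single k a) := by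
  rw [Matrix.mul_assoc, shiftX_mul_apply, ← Matrix.conjTranspose_conjTranspose (M * _),
    Matrix.conjTranspose_mul, Matrix.conjTranspose_conjTranspose, Matrix.conjTranspose_apply,
    shiftX_mul_apply, Matrix.conjTranspose_apply, star_star]

theorem phaseZ_conj_apply (k : Fin n) (a : ZMod d) (M : Op d n) (x y : Idx d n) :
    (phaseZ k a * M * (phaseZ k a)ᴴ) x y = ZMod.stdAddChar (a * (x k - y k)) * M x y := by
  rw [(isUnitaryRep_phaseZ k).star, phaseZ, phaseZ, Matrix.mul_diagonal, Matrix.diagonal_mul,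
    mul_sub, sub_eq_add_neg, AddChar.map_add_eq_mul, neg_mul]
  ring

omit [NeZero d] in
theorem genZ_eq_diagonal (k : Fin n) (j : ZMod d) :
    genZ k j = Matrix.diagonal fun x : Idx d n => if x k = j then (1 : ℂ) else 0 := by
  ext x y
  simp only [genZ, onQudit, proj, eigvecZ, Matrix.of_apply, Matrix.vecMulVec_apply,
    Matrix.diagonal_apply]
  by_cases hxy : x = y
  · subst hxy
    simp only [implies_true, if_true, Pi.single_apply, Pi.star_apply]
    split_ifs <;> simp
  · simp only [if_neg hxy, Pi.single_apply, Pi.star_apply]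
    rw [ite_eq_right_iff]
    intro h
    have hk : x k ≠ y k := fun hk => hxy (funext fun l => by
      by_cases hl : l = k
      · rw [hl, hk]
      · exact h l hl)
    by_cases hx : x k = j
    · rw [if_neg (c := y k = j) (fun hy => hk (hx.trans hy.symm))]
      simp
    · rw [if_neg hx]
      simp

theorem genZ_eq_spectralProj (k : Fin n) (j : ZMod d) : genZ k j = spectralProj (phaseZ k) j := by
  have hd : (d : ℂ) ≠ 0 := Nat.cast_ne_zero.2 (NeZero.ne d)
  rw [genZ_eq_diagonal]
  ext x y
  simp only [spectralProj, phaseZ, Matrix.smul_apply, Matrix.sum_apply, Matrix.diagonal_apply,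
    smul_eq_mul]
  by_cases hxy : x = y
  · have h : ∀ a, (ZMod.stdAddChar (-(j * a)) * ZMod.stdAddChar (a * x k) : ℂ) =
        ZMod.stdAddChar (a * (x k - j)) := fun a => by
      rw [← AddChar.map_add_eq_mul]
      congr 1
      ring
    simp only [if_pos hxy, h, sum_stdAddChar_mul, sub_eq_zero]
    split_ifs <;> simp [hd]
  · simp [if_neg hxy]

theorem genX_eq_spectralProj (k : Fin n) (j : ZMod d) : genX k j = spectralProj (shiftX k) j := by
  have hd : (d : ℂ) ≠ 0 := Nat.cast_ne_zero.2 (NeZero.ne d)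
  have hsq : (((Real.sqrt d : ℝ) : ℂ)⁻¹) * (((Real.sqrt d : ℝ) : ℂ)⁻¹) = (d : ℂ)⁻¹ := by
    rw [← mul_inv, ← Complex.ofReal_mul, Real.mul_self_sqrt (Nat.cast_nonneg d),
      Complex.ofReal_natCast]
  ext x y
  simp only [spectralProj, shiftX, Matrix.smul_apply, Matrix.sum_apply, genX, onQudit, proj,
    eigvecX, Matrix.of_apply, Matrix.vecMulVec_apply, smul_eq_mul, Pi.star_apply]
  -- For a given entry at most one power of the shift contributes, namely `a = x k - y k`.
  have hiff : ∀ a, x = y + Pi.single k a ↔ (∀ l, l ≠ k → x l = y l) ∧ x k - y k = a := by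
    intro a
    constructor
    · rintro rfl
      exact ⟨fun l hl => by simp [hl], by simp⟩
    · rintro ⟨h, rfl⟩
      ext l
      by_cases hl : l = k
      · subst hl
        simp
      · simp [hl, h l hl]
  simp only [hiff]
  by_cases h : ∀ l, l ≠ k → x l = y l
  · rw [if_pos h]
    simp only [and_iff_right h, mul_ite, mul_one, mul_zero, Finset.sum_ite_eq, Finset.mem_univ,
      if_true]
    rw [star_mul, RCLike.star_def, ← AddChar.map_neg_eq_conj, neg_neg, ← hsq,
      show -(j * (x k - y k)) = -(j * x k) + j * y k by ring, AddChar.map_add_eq_mul]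
    simp only [map_inv₀, Complex.conj_ofReal]
    ring
  · simp [h]

theorem fisherInfo_of_posDef {ρ : Op d n} (hρ : ρ.PosDef) :
    fisherInfo ρ = ((∑ k : Fin n,
      (2 * (d : ℝ)⁻¹ * ∑ a, (ρ * (cfc Real.log ρ -
          cfc Real.log (shiftX k a * ρ * (shiftX k a)ᴴ))).trace.re +
        2 * (d : ℝ)⁻¹ * ∑ a, (ρ * (cfc Real.log ρ -
          cfc Real.log (phaseZ k a * ρ * (phaseZ k a)ᴴ))).trace.re) : ℝ) : EReal) := by
  simp only [fisherInfo, genX_eq_spectralProj, genZ_eq_spectralProj, Finset.sum_add_distrib,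
    (isUnitaryRep_shiftX _).sum_fisherInfoAlong hρ, (isUnitaryRep_phaseZ _).sum_fisherInfoAlong hρ,
    EReal.coe_add, ereal_coe_sum]

theorem fisherInfoAlong_ne_top_of_fisherInfo_ne_top {ρ : Op d n} (h : fisherInfo ρ ≠ ⊤)
    (k : Fin n) (j : ZMod d) :
    fisherInfoAlong ρ (genX k j) ≠ ⊤ ∧ fisherInfoAlong ρ (genZ k j) ≠ ⊤ := by
  have hb : ∀ k j, fisherInfoAlong ρ (genX k j) + fisherInfoAlong ρ (genZ k j) ≠ ⊥ := fun k j => by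
    simp [EReal.add_eq_bot_iff, fisherInfoAlong_ne_bot]
  have h1 := ereal_ne_top_of_sum_ne_top (fun k _ => ereal_sum_ne_bot fun j _ => hb k j) h
    (Finset.mem_univ k)
  have h2 := ereal_ne_top_of_sum_ne_top (fun j _ => hb k j) h1 (Finset.mem_univ j)
  exact (EReal.add_ne_top_iff_ne_top₂ (fisherInfoAlong_ne_bot _ _)
    (fisherInfoAlong_ne_bot _ _)).1 h2

/-- A matrix whose kernel is preserved by the spectral projections of all `X_k` and `Z_k` is zero
or has trivial kernel. -/
theorem mulVec_injective_of_invariant_ker {ρ : Op d n} (hρ : ρ ≠ 0)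
    (hX : ∀ (k : Fin n) (j : ZMod d) v, ρ *ᵥ v = 0 → ρ *ᵥ (genX k j *ᵥ v) = 0)
    (hZ : ∀ (k : Fin n) (j : ZMod d) v, ρ *ᵥ v = 0 → ρ *ᵥ (genZ k j *ᵥ v) = 0)
    {v : Idx d n → ℂ} (hv : ρ *ᵥ v = 0) : v = 0 := by
  by_contra hv0
  obtain ⟨x, hx⟩ := Function.ne_iff.1 hv0
  -- Projecting with the `Z_k` one qudit at a time cuts `v` down to `v x` times the basis vector at
  -- `x`.
  have hcut : ∀ s : Finset (Fin n), ρ *ᵥ (fun y => if ∀ k ∈ s, y k = x k then v y else 0) = 0 := by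
    intro s
    induction s using Finset.induction_on with
    | empty => simpa using hv
    | insert k s _ ih =>
      convert hZ k (x k) _ ih using 2
      ext y
      rw [genZ_eq_diagonal, Matrix.mulVec_diagonal]
      simp only [Finset.forall_mem_insert]
      by_cases h : y k = x k <;> simp [h]
  have hshift : ∀ (k : Fin n) (a : ZMod d) w, ρ *ᵥ w = 0 → ρ *ᵥ (shiftX k a *ᵥ w) = 0 := by
    intro k a w hw
    rw [← IsUnitaryRep.sum_smul_spectralProj (shiftX k) a, Matrix.sum_mulVec, Matrix.mulVec_sum]
    refine Finset.sum_eq_zero fun j _ => ?_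
    rw [Matrix.smul_mulVec, Matrix.mulVec_smul, ← genX_eq_spectralProj, hX k j w hw, smul_zero]
  have hbasis : ρ *ᵥ Pi.single x 1 = 0 := by
    have h1 : (fun y => if ∀ k ∈ Finset.univ, y k = x k then v y else 0) =
        v x • Pi.single x (1 : ℂ) := by
      ext y
      by_cases h : y = x
      · simp [h]
      · have : ¬ ∀ k ∈ Finset.univ, y k = x k := fun h' => h (funext fun k => h' k (by simp))
        rw [if_neg this]
        simp [h]
    have h2 := hcut Finset.univ
    rw [h1, Matrix.mulVec_smul] at h2
    exact (smul_eq_zero.1 h2).resolve_left hx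
  -- The shifts carry this one basis vector to all others, so `ρ` kills the whole basis.
  have htrans : ∀ t : Idx d n, ∀ z, ρ *ᵥ Pi.single z 1 = 0 → ρ *ᵥ Pi.single (z + t) 1 = 0 := by
    intro t
    rw [← Finset.univ_sum_single t]
    refine Finset.sum_induction _ (fun t => ∀ z, ρ *ᵥ Pi.single z 1 = 0 →
      ρ *ᵥ Pi.single (z + t) 1 = 0) (fun a b ha hb z hz => ?_) (fun z hz => ?_) fun k _ z hz => ?_
    · rw [← add_assoc]
      exact hb _ (ha _ hz)
    · rwa [add_zero]
    · convert hshift k (t k) _ hz using 2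
      ext y
      simp [shiftX, Pi.single_apply]
  refine hρ (Matrix.ext fun i j => ?_)
  have := congrFun (htrans (j - x) x hbasis) i
  simpa using this

theorem posDef_of_fisherInfo_ne_top {ρ : Op d n} (hρ : IsState ρ) (h : fisherInfo ρ ≠ ⊤) :
    ρ.PosDef := by
  have hne : ρ ≠ 0 := fun h0 => by simpa [h0] using hρ.2
  refine Matrix.PosDef.of_dotProduct_mulVec_pos hρ.1.1 fun v hv => ?_
  refine lt_of_le_of_ne (hρ.1.dotProduct_mulVec_nonneg v) fun h0 => hv ?_
  refine mulVec_injective_of_invariant_ker hne (fun k j w hw => ?_) (fun k j w hw => ?_)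
    ((hρ.1.dotProduct_mulVec_zero_iff v).1 h0.symm)
  · have := (fisherInfoAlong_ne_top_of_fisherInfo_ne_top h k j).1
    rw [genX_eq_spectralProj] at this ⊢
    exact mulVec_eq_zero_of_fisherInfoAlong_ne_top
      ((isUnitaryRep_shiftX k).spectralProj_mul_self j) this hw
  · have := (fisherInfoAlong_ne_top_of_fisherInfo_ne_top h k j).2
    rw [genZ_eq_spectralProj] at this ⊢
    exact mulVec_eq_zero_of_fisherInfoAlong_ne_top
      ((isUnitaryRep_phaseZ k).spectralProj_mul_self j) this hw

end Weyl

/-! ### Positive definiteness under Kraus maps -/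

section KrausPosDef

variable {ι κ η : Type*} [Fintype ι] [Fintype κ] [Fintype η]

theorem posDef_krausMap {K : η → Matrix κ ι ℂ} {ρ : Matrix ι ι ℂ} (hρ : ρ.PosDef)
    (hK : ∀ v, (∀ m, (K m)ᴴ *ᵥ v = 0) → v = 0) : (krausMap K ρ).PosDef := by
  have hsemi : ∀ m, (K m * ρ * (K m)ᴴ).PosSemidef := fun m =>
    hρ.posSemidef.mul_mul_conjTranspose_same _
  refine Matrix.PosDef.of_dotProduct_mulVec_pos ?_ fun v hv => ?_
  · rw [krausMap, Matrix.IsHermitian, Matrix.conjTranspose_sum]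
    exact Finset.sum_congr rfl fun m _ => (hsemi m).1
  · have h : ∃ m, (K m)ᴴ *ᵥ v ≠ 0 := by
      by_contra! h
      exact hv (hK v h)
    obtain ⟨m, hm⟩ := h
    rw [krausMap, Matrix.sum_mulVec, dotProduct_sum]
    refine Finset.sum_pos' (fun m _ => (hsemi m).dotProduct_mulVec_nonneg v)
      ⟨m, Finset.mem_univ m, ?_⟩
    have := hρ.dotProduct_mulVec_pos hm
    rwa [Matrix.star_mulVec, Matrix.conjTranspose_conjTranspose, ← Matrix.dotProduct_mulVec,
      Matrix.mulVec_mulVec, Matrix.mulVec_mulVec] at this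

open scoped MatrixOrder Matrix.Norms.L2Operator in
theorem exists_eq_conjTranspose_mul_self [DecidableEq ι] {σ : Matrix ι ι ℂ} (hσ : σ.PosSemidef) :
    ∃ C : Matrix ι ι ℂ, σ = Cᴴ * C :=
  CStarAlgebra.nonneg_iff_eq_star_mul_self.mp hσ.nonneg

end KrausPosDef

/-! ### Convolution as a Weyl-covariant channel -/

section Convolution

variable {d : ℕ} [Fact d.Prime] {n : ℕ}

/-- Solving for the old labels replaces `(G⁻¹)ᵀ` by `Gᵀ`, so the entries of the convolution involve
`G` without inverses. -/
theorem keyMap_eq_iff {G : Matrix (Fin 2) (Fin 2) (ZMod d)} (hG : IsUnit G)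
    (y x : Idx d n × Idx d n) :
    y = keyMap G x ↔ x = (G 0 0 • y.1 + G 1 0 • y.2, G 0 1 • y.1 + G 1 1 • y.2) := by
  have hdet : IsUnit G.det := (Matrix.isUnit_iff_isUnit_det G).1 hG
  have h1 : Gᵀ * (G⁻¹)ᵀ = 1 := by
    rw [← Matrix.transpose_mul, Matrix.nonsing_inv_mul G hdet, Matrix.transpose_one]
  have h2 : (G⁻¹)ᵀ * Gᵀ = 1 := by
    rw [← Matrix.transpose_mul, Matrix.mul_nonsing_inv G hdet, Matrix.transpose_one]
  have hvec : ∀ u v w z : ZMod d, ![u, v] = ((G⁻¹)ᵀ *ᵥ ![w, z]) ↔ ![w, z] = Gᵀ *ᵥ ![u, v] := by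
    intro u v w z
    constructor <;> intro h <;> rw [h, Matrix.mulVec_mulVec]
    · rw [h1, Matrix.one_mulVec]
    · rw [h2, Matrix.one_mulVec]
  have hpair : ∀ (u v : ZMod d) (f : Fin 2 → ZMod d), ![u, v] = f ↔ u = f 0 ∧ v = f 1 := by
    intro u v f
    simp [funext_iff, Fin.forall_fin_two]
  simp only [hpair] at hvec
  obtain ⟨y1, y2⟩ := y
  obtain ⟨x1, x2⟩ := x
  simp only [keyMap, Prod.mk.injEq, funext_iff, ← forall_and, hvec]
  simp [Matrix.mulVec, dotProduct, Fin.sum_univ_two]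

theorem convolution_apply {G : Matrix (Fin 2) (Fin 2) (ZMod d)} (hG : IsUnit G) (ρ σ : Op d n)
    (x y : Idx d n) :
    convolution G ρ σ x y = ∑ b, ρ (G 0 0 • x + G 1 0 • b) (G 0 0 • y + G 1 0 • b) *
      σ (G 0 1 • x + G 1 1 • b) (G 0 1 • y + G 1 1 • b) := by
  simp only [convolution, partialTraceB, Matrix.of_apply]
  refine Finset.sum_congr rfl fun b _ => ?_
  simp only [Matrix.mul_apply, Matrix.conjTranspose_apply, keyUnitary, Matrix.of_apply,
    keyMap_eq_iff hG]
  simp [apply_ite star]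

/-- Exchanging the columns of `G` only negates the determinant. The diagonal of the new matrix
consists of the off-diagonal entries of `G`, so all four entries must be nonzero in the end. -/
theorem convolution_swap {G : Matrix (Fin 2) (Fin 2) (ZMod d)} (hG : IsUnit G) (ρ σ : Op d n) :
    IsUnit (Matrix.of fun i j => G i (1 - j)) ∧
      convolution G ρ σ = convolution (Matrix.of fun i j => G i (1 - j)) σ ρ := by
  have hG' : IsUnit (Matrix.of fun i j => G i (1 - j)) := by
    rw [Matrix.isUnit_iff_isUnit_det, Matrix.det_fin_two] at hG ⊢
    rw [← IsUnit.neg_iff]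
    convert hG using 1
    simp
  refine ⟨hG', ?_⟩
  ext x y
  rw [convolution_apply hG, convolution_apply hG']
  simp [mul_comm]

/-- The Kraus operators of `ρ ↦ ρ ⊠ σ`, where `σ = C† C`. -/
noncomputable def convolutionKraus (G : Matrix (Fin 2) (Fin 2) (ZMod d)) (C : Op d n)
    (m : Idx d n × Idx d n) : Op d n :=
  Matrix.of fun a x =>
    if G 0 0 • a + G 1 0 • m.1 = x then star (C m.2 (G 0 1 • a + G 1 1 • m.1)) else 0

theorem convolution_eq_krausMap {G : Matrix (Fin 2) (Fin 2) (ZMod d)} (hG : IsUnit G)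
    (ρ C : Op d n) : convolution G ρ (Cᴴ * C) = krausMap (convolutionKraus G C) ρ := by
  ext x y
  rw [convolution_apply hG, krausMap, Matrix.sum_apply, Fintype.sum_prod_type]
  refine Finset.sum_congr rfl fun b _ => ?_
  rw [Matrix.mul_apply, Finset.mul_sum]
  refine Finset.sum_congr rfl fun m _ => ?_
  simp only [Matrix.mul_apply, Matrix.conjTranspose_apply, convolutionKraus, Matrix.of_apply,
    ite_mul, zero_mul, Finset.sum_ite_eq, Finset.mem_univ, if_true, apply_ite star, star_star,
    star_zero, mul_ite, mul_zero]
  ring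

/-- After the bijective change of labels `(a, b) ↦ Gᵀ (a, b)`, the first label gives the identity
and the second sums the diagonal of `σ` to its trace `1`. -/
theorem sum_convolutionKraus {G : Matrix (Fin 2) (Fin 2) (ZMod d)} (hG : IsUnit G)
    {C : Op d n} (hC : (Cᴴ * C).trace = 1) :
    ∑ m, (convolutionKraus G C m)ᴴ * convolutionKraus G C m = 1 := by
  have hbij : Function.Bijective fun y : Idx d n × Idx d n =>
      ((G 0 0 • y.1 + G 1 0 • y.2, G 0 1 • y.1 + G 1 1 • y.2) : Idx d n × Idx d n) :=
    Function.bijective_iff_has_inverse.2 ⟨keyMap G,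
      fun y => ((keyMap_eq_iff hG y _).2 rfl).symm, fun x => ((keyMap_eq_iff hG _ x).1 rfl).symm⟩
  ext x y
  let F : Idx d n × Idx d n → ℂ := fun w => if w.1 = x ∧ w.1 = y then (Cᴴ * C) w.2 w.2 else 0
  have h1 : (∑ m, (convolutionKraus G C m)ᴴ * convolutionKraus G C m) x y =
      ∑ z : Idx d n × Idx d n, F (G 0 0 • z.1 + G 1 0 • z.2, G 0 1 • z.1 + G 1 1 • z.2) := by
    rw [Matrix.sum_apply, Fintype.sum_prod_type, Fintype.sum_prod_type_right]
    refine Finset.sum_congr rfl fun b _ => ?_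
    simp only [Matrix.mul_apply, Matrix.conjTranspose_apply, convolutionKraus, Matrix.of_apply, F]
    rw [Finset.sum_comm]
    refine Finset.sum_congr rfl fun a _ => ?_
    by_cases hx : G 0 0 • a + G 1 0 • b = x
    · by_cases hy : G 0 0 • a + G 1 0 • b = y
      · rw [if_pos ⟨hx, hy⟩]
        refine Finset.sum_congr rfl fun m _ => ?_
        rw [if_pos hx, if_pos hy, star_star, mul_comm]
      · rw [if_neg fun h => hy h.2]
        exact Finset.sum_eq_zero fun m _ => by rw [if_neg hy, mul_zero]
    · rw [if_neg fun h => hx h.1]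
      exact Finset.sum_eq_zero fun m _ => by rw [if_neg hx, star_zero, zero_mul]
  refine h1.trans ((hbij.sum_comp F).trans ?_)
  rw [Fintype.sum_prod_type]
  by_cases hxy : x = y
  · subst hxy
    simpa [F, Matrix.trace] using hC
  · rw [Matrix.one_apply_ne hxy]
    refine Finset.sum_eq_zero fun w _ => Finset.sum_eq_zero fun b _ => ?_
    exact if_neg fun h => hxy (h.1.symm.trans h.2)

/-- Since `G 1 1` is invertible, `b` can be chosen so that the Kraus coefficient at `a` is a
prescribed nonzero entry of `C`. Since `G 0 0` is invertible, no other coordinate of `v` enters the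
same equation. -/
theorem eq_zero_of_convolutionKraus {G : Matrix (Fin 2) (Fin 2) (ZMod d)} (h00 : G 0 0 ≠ 0)
    (h11 : G 1 1 ≠ 0) {C : Op d n} (hC : C ≠ 0) (v : Idx d n → ℂ)
    (h : ∀ m, (convolutionKraus G C m)ᴴ *ᵥ v = 0) : v = 0 := by
  obtain ⟨m, u, hmu⟩ : ∃ m u, C m u ≠ 0 := by
    by_contra! h0
    exact hC (Matrix.ext h0)
  ext a
  let b : Idx d n := (G 1 1)⁻¹ • (u - G 0 1 • a)
  have h1 := congrFun (h (b, m)) (G 0 0 • a + G 1 0 • b)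
  have h2 : G 0 1 • a + G 1 1 • b = u := by
    simp [b, smul_smul, mul_inv_cancel₀ h11]
  have h3 : ∀ a', G 0 0 • a' = G 0 0 • a ↔ a' = a := fun a' => smul_right_inj h00
  simp only [Matrix.mulVec, dotProduct, Matrix.conjTranspose_apply, convolutionKraus,
    Matrix.of_apply, add_left_inj, h3] at h1
  simpa [apply_ite star, h2, hmu] using h1

theorem phaseZ_conj_convolution {G : Matrix (Fin 2) (Fin 2) (ZMod d)} (hG : IsUnit G)
    (ρ σ : Op d n) (k : Fin n) (a : ZMod d) :
    convolution G (phaseZ k a * ρ * (phaseZ k a)ᴴ) σ =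
      phaseZ k (G 0 0 * a) * convolution G ρ σ * (phaseZ k (G 0 0 * a))ᴴ := by
  ext x y
  simp only [phaseZ_conj_apply, convolution_apply hG, Finset.mul_sum]
  refine Finset.sum_congr rfl fun b _ => ?_
  have h : a * ((G 0 0 • x + G 1 0 • b) k - (G 0 0 • y + G 1 0 • b) k) =
      G 0 0 * a * (x k - y k) := by
    simp only [Pi.add_apply, Pi.smul_apply, smul_eq_mul]
    ring
  rw [h, mul_assoc]

theorem shiftX_conj_convolution {G : Matrix (Fin 2) (Fin 2) (ZMod d)} (hG : IsUnit G)
    (h11 : G 1 1 ≠ 0) (ρ σ : Op d n) (k : Fin n) (a : ZMod d) :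
    convolution G (shiftX k (G.det * (G 1 1)⁻¹ * a) * ρ * (shiftX k (G.det * (G 1 1)⁻¹ * a))ᴴ) σ =
      shiftX k a * convolution G ρ σ * (shiftX k a)ᴴ := by
  ext x y
  simp only [shiftX_conj_apply, convolution_apply hG]
  -- This translation of `b` cancels the effect of the shift on the argument of `σ`; the argument of
  -- `ρ` is left shifted by `G 0 0 * a - G 1 0 * (G 1 1)⁻¹ * G 0 1 * a = G.det * (G 1 1)⁻¹ * a`.
  refine Fintype.sum_equiv (Equiv.addRight (Pi.single k ((G 1 1)⁻¹ * G 0 1 * a))) _ _ fun b => ?_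
  have h1 : ∀ x : Idx d n, G 0 0 • x + G 1 0 • b - Pi.single k (G.det * (G 1 1)⁻¹ * a) =
      G 0 0 • (x - Pi.single k a) + G 1 0 • (b + Pi.single k ((G 1 1)⁻¹ * G 0 1 * a)) := by
    intro x
    have : G.det * (G 1 1)⁻¹ * a = G 0 0 * a - G 1 0 * ((G 1 1)⁻¹ * G 0 1 * a) := by
      rw [Matrix.det_fin_two]
      field_simp
    rw [this, Pi.single_sub, smul_sub, smul_add, ← Pi.single_smul, ← Pi.single_smul, smul_eq_mul,
      smul_eq_mul]
    abel
  have h2 : ∀ x : Idx d n, G 0 1 • x + G 1 1 • b =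
      G 0 1 • (x - Pi.single k a) + G 1 1 • (b + Pi.single k ((G 1 1)⁻¹ * G 0 1 * a)) := by
    intro x
    have : G 0 1 * a = G 1 1 * ((G 1 1)⁻¹ * G 0 1 * a) := by
      field_simp
    rw [smul_sub, smul_add, ← Pi.single_smul, ← Pi.single_smul, smul_eq_mul, smul_eq_mul, ← this]
    abel
  rw [h1, h1, h2 x, h2 y]
  rfl

theorem fisherInfo_convolution_le {G : Matrix (Fin 2) (Fin 2) (ZMod d)} (hG : IsUnit G)
    (h00 : G 0 0 ≠ 0) (h11 : G 1 1 ≠ 0) {ρ σ : Op d n} (hρ : IsState ρ) (hσ : IsState σ) :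
    fisherInfo (convolution G ρ σ) ≤ fisherInfo ρ := by
  by_cases htop : fisherInfo ρ = ⊤
  · rw [htop]
    exact le_top
  have hpd := posDef_of_fisherInfo_ne_top hρ htop
  obtain ⟨C, rfl⟩ := exists_eq_conjTranspose_mul_self hσ.1
  have hC : C ≠ 0 := fun h => by simpa [h] using hσ.2
  have hout : ∀ τ : Op d n, τ.PosDef → (convolution G τ (Cᴴ * C)).PosDef := fun τ hτ => by
    rw [convolution_eq_krausMap hG]
    exact posDef_krausMap hτ (eq_zero_of_convolutionKraus h00 h11 hC)
  have hmono : ∀ τ : Op d n, τ.PosDef →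
      (convolution G ρ (Cᴴ * C) * (cfc Real.log (convolution G ρ (Cᴴ * C)) -
        cfc Real.log (convolution G τ (Cᴴ * C)))).trace.re ≤
      (ρ * (cfc Real.log ρ - cfc Real.log τ)).trace.re := fun τ hτ => by
    have h1 := hout ρ hpd
    have h2 := hout τ hτ
    simp only [convolution_eq_krausMap hG] at h1 h2 ⊢
    exact relEnt_krausMap_le (sum_convolutionKraus hG hσ.2) hpd hτ h1 h2
  have hdet : G.det ≠ 0 := ((Matrix.isUnit_iff_isUnit_det G).1 hG).ne_zero
  rw [fisherInfo_of_posDef hpd, fisherInfo_of_posDef (hout ρ hpd), EReal.coe_le_coe_iff]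
  refine Finset.sum_le_sum fun k _ => add_le_add ?_ ?_
  · refine mul_le_mul_of_nonneg_left ?_ (by positivity)
    -- Reindexing the input sum by a nonzero factor makes its exponents match those produced by
    -- covariance.
    rw [← (mulLeft_bijective₀ (G.det * (G 1 1)⁻¹)
      (mul_ne_zero hdet (inv_ne_zero h11))).sum_comp fun a => (ρ * (cfc Real.log ρ -
        cfc Real.log (shiftX k a * ρ * (shiftX k a)ᴴ))).trace.re]
    refine Finset.sum_le_sum fun a _ => ?_
    rw [← shiftX_conj_convolution hG h11]
    exact hmono _ (posDef_unitary_conj ((isUnitaryRep_shiftX k).star_mul_self _) hpd)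
  · refine mul_le_mul_of_nonneg_left ?_ (by positivity)
    -- For `Z` the rescaled exponent appears at the output, so the output sum is the one reindexed.
    rw [← (mulLeft_bijective₀ (G 0 0) h00).sum_comp fun a => (convolution G ρ (Cᴴ * C) *
      (cfc Real.log (convolution G ρ (Cᴴ * C)) - cfc Real.log (phaseZ k a *
        convolution G ρ (Cᴴ * C) * (phaseZ k a)ᴴ))).trace.re]
    refine Finset.sum_le_sum fun a _ => ?_
    rw [← phaseZ_conj_convolution hG]
    exact hmono _ (posDef_unitary_conj ((isUnitaryRep_phaseZ k).star_mul_self _) hpd)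

end Convolution

theorem theorem3 {d : ℕ} [Fact d.Prime] {n : ℕ}
    (G : Matrix (Fin 2) (Fin 2) (ZMod d))
    (hG_pos : ∀ i j, G i j ≠ 0) (hG_inv : IsUnit G)
    (ρ σ : QuditConv.Op d n) (hρ : QuditConv.IsState ρ) (hσ : QuditConv.IsState σ) :
    QuditConv.fisherInfo (QuditConv.convolution G ρ σ) ≤
      min (QuditConv.fisherInfo ρ) (QuditConv.fisherInfo σ) := by
  obtain ⟨hswap, hconv⟩ := convolution_swap hG_inv ρ σ
  refine le_min (fisherInfo_convolution_le hG_inv (hG_pos _ _) (hG_pos _ _) hρ hσ) ?_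
  rw [hconv]
  exact fisherInfo_convolution_le hswap (hG_pos _ _) (hG_pos _ _) hσ hρ
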